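/- Let $V$ be a finite-dimensional real inner product space with a basis $e_1,\dots,e_n$, let $\mathbf g_1,\dots,\mathbf g_d:[0,1]\to V$ be Lipschitz paths with coordinates $\mathbf g_j=(g_{1,j},\dots,g_{n,j})$, and let $\mathbf x:[0,1]^d\to V$, $\mathbf x(s_1,\dots,s_d)=\sum_{j=1}^d\mathbf g_j(s_j)$. For $\pi\in\Sigma_m$ (the symmetric group on $[m]=\{1,\dots,m\}$) put $\Delta^m_\pi=\{t\in[0,1]^m: t_{\pi(1)}<\dots<t_{\pi(m)}\}$ and $\Delta^m=\Delta^m_{\mathrm{id}}$. For $m\ge 0$, order-preserving injections $\mathbf P=(P_1,\dots,P_m)$, $P_i:[d]\to[n]$, and permutations $\boldsymbol\pi=(\pi_1,\dots,\pi_d)\in\Sigma_m^d$, the level $m$ mapping space monomial of $\mathbf x$ is $$\Phi_m^{\mathbf P,\boldsymbol\pi}(\mathbf x)=\int_{\Delta^m_{\pi_1}\times\dots\times\Delta^m_{\pi_d}}\ \prod_{i=1}^m J[\mathbf x_{P_i}](t_{i,1},\dots,t_{i,d})\,d\mathbf t,\qquad J[\mathbf x_P]=\det\Big(\frac{\partial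 x_{P(q)}}{\partial s_j}\Big)_{q,j=1}^d ,$$ where $(t_{1,j},\dots,t_{m,j})$ is the variable in $\Delta^m_{\pi_j}$. For a multi-index $I\in[n]^m$ the path signature coordinate of a Lipschitz path $\mathbf g=(g_1,\dots,g_n)$ is $S^I_m(\mathbf g)=\int_{\Delta^m}\prod_{i=1}^m g_{I_i}'(t_i)\,dt$. Then the integrals that define $\Phi_m^{\mathbf P,\boldsymbol\pi}(\mathbf x)$ and the $S^I_m(\mathbf g_j)$ converge absolutely, and for all $m\ge 0$, $\mathbf P$ and $\boldsymbol\pi$, $$\Phi_m^{\mathbf P,\boldsymbol\pi}(\mathbf x)=\sum_{\boldsymbol\sigma=(\sigma_1,\dots,\sigma_m)\in\Sigma_d^m}\Big(\prod_{i=1}^m\operatorname{sgn}(\sigma_i)\Big)\prod_{j=1}^d S_m^{Q(\mathbf P,\boldsymbol\pi,\boldsymbol\sigma,j)}(\mathbf g_j),$$ where $Q(\mathbf P,\boldsymbol\pi,\boldsymbol\sigma,j)\in[n]^m$ has $k$-th entry $P_i(\sigma_i^{-1}(j))$ with $i=\pi_j(k)$. Call a path $\mathbf g:[0,1]\to V$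 tree-like if there are an $\mathbb R$-tree $\mathfrak T$ (a metric space in which any two points are joined by a unique arc, and this arc is isometric to a real interval) and continuous maps $\phi:[0,1]\to\mathfrak T$, $\psi:\mathfrak T\to V$ with $\phi(0)=\phi(1)$ and $\mathbf g=\psi\circ\phi$. If at least one $\mathbf g_j$ is tree-like, then $\Phi_m^{\mathbf P,\boldsymbol\pi}(\mathbf x)=0$ for every $m\ge 1$ and all $\mathbf P$, $\boldsymbol\pi$. -/

import Mathlib

open MeasureTheory

universe u

namespace MappingSpaceSignature

noncomputable section

/-- The unit cube `[0,1]^d`. -/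
def cube (d : ℕ) : Set (Fin d → ℝ) := {s | ∀ j, s j ∈ Set.Icc (0 : ℝ) 1}

/-- The partial derivative `∂ x_k / ∂ s_j` of the `k`-th coordinate (in the basis `b`) of a map
`x` on the unit cube. It is taken inside `[0,1]`, so it only depends on `x` on the cube. -/
def partialDeriv {V : Type*} [NormedAddCommGroup V] [InnerProductSpace ℝ V] {n d : ℕ}
    (b : Module.Basis (Fin n) ℝ V) (x : (Fin d → ℝ) → V) (k : Fin n) (j : Fin d)
    (s : Fin d → ℝ) : ℝ :=
  derivWithin (fun r : ℝ => b.repr (x (Function.update s j r)) k) (Set.Icc 0 1) (s j)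

/-- The Jacobian minor `J[x_P]` for an order-preserving injection `P : [d] → [n]`. -/
def jacobianMinor {V : Type*} [NormedAddCommGroup V] [InnerProductSpace ℝ V] {n d : ℕ}
    (b : Module.Basis (Fin n) ℝ V) (x : (Fin d → ℝ) → V) (P : Fin d ↪o Fin n)
    (s : Fin d → ℝ) : ℝ :=
  Matrix.det (Matrix.of fun q j : Fin d => partialDeriv b x (P q) j s)

/-- The permuted simplex `0 ≤ t_{π(1)} < ⋯ < t_{π(m)} ≤ 1`. -/
def permutedSimplex {m : ℕ} (π : Equiv.Perm (Fin m)) : Set (Fin m → ℝ) :=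
  {t | (∀ i, t i ∈ Set.Icc (0 : ℝ) 1) ∧ StrictMono fun i => t (π i)}

/-- The product of the permuted simplices of `π_1, …, π_d`; a point is `t = (t_{i,j})`, and its
`j`-th column `(t_{1,j}, …, t_{m,j})` lies in the simplex of `π_j`. -/
def integrationDomain {m d : ℕ} (π : Fin d → Equiv.Perm (Fin m)) :
    Set (Fin m → Fin d → ℝ) :=
  {t | ∀ j, (fun i => t i j) ∈ permutedSimplex (π j)}

/-- The integrand `∏ i, J[x_{P_i}](t_i)` of a mapping space monomial. -/
def monomialIntegrand {V : Type*} [NormedAddCommGroup V] [InnerProductSpace ℝ V] {n d m : ℕ}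
    (b : Module.Basis (Fin n) ℝ V) (x : (Fin d → ℝ) → V) (P : Fin m → (Fin d ↪o Fin n))
    (t : Fin m → Fin d → ℝ) : ℝ :=
  ∏ i, jacobianMinor b x (P i) (t i)

/-- The level `m` mapping space monomial of `x` with respect to `(P, π)`. -/
def mappingSpaceMonomial {V : Type*} [NormedAddCommGroup V] [InnerProductSpace ℝ V]
    {n d m : ℕ} (b : Module.Basis (Fin n) ℝ V) (x : (Fin d → ℝ) → V)
    (P : Fin m → (Fin d ↪o Fin n)) (π : Fin d → Equiv.Perm (Fin m)) : ℝ :=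
  ∫ t in integrationDomain π, monomialIntegrand b x P t

/-- The integrand `∏ i, g'_{I_i}(t_i)` of a path signature coordinate. -/
def pathIntegrand {V : Type*} [NormedAddCommGroup V] [InnerProductSpace ℝ V] {n m : ℕ}
    (b : Module.Basis (Fin n) ℝ V) (g : ℝ → V) (I : Fin m → Fin n) (t : Fin m → ℝ) : ℝ :=
  ∏ i, derivWithin (fun r : ℝ => b.repr (g r) (I i)) (Set.Icc 0 1) (t i)

/-- The path signature coordinate of `g` with multi-index `I`: the integral of
`dg_{I_1}(t_1) ⋯ dg_{I_m}(t_m)` over the standard simplex `0 ≤ t_1 < ⋯ < t_m ≤ 1`. -/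
def pathSignature {V : Type*} [NormedAddCommGroup V] [InnerProductSpace ℝ V] {n m : ℕ}
    (b : Module.Basis (Fin n) ℝ V) (g : ℝ → V) (I : Fin m → Fin n) : ℝ :=
  ∫ t in permutedSimplex (1 : Equiv.Perm (Fin m)), pathIntegrand b g I t

/-- The multi-index `π_j⁻¹ · (P_1(σ_1⁻¹(j)), …, P_m(σ_m⁻¹(j)))`, where a permutation `τ` acts
on a multi-index `a` by `(τ · a)_k = a_{τ⁻¹(k)}`. -/
def multiIndex {n d m : ℕ} (P : Fin m → (Fin d ↪o Fin n)) (π : Fin d → Equiv.Perm (Fin m))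
    (σ : Fin m → Equiv.Perm (Fin d)) (j : Fin d) : Fin m → Fin n :=
  fun k => P (π j k) ((σ (π j k))⁻¹ j)

/-- An `ℝ`-tree: a metric space in which any two points are joined by a geodesic, an isometric
copy of a real interval, and this is the only arc that joins them. -/
def IsRealTree (T : Type*) [MetricSpace T] : Prop :=
  ∀ p q : T, ∃ γ : ℝ → T,
    γ 0 = p ∧ γ (dist p q) = q ∧
    (∀ r ∈ Set.Icc 0 (dist p q), ∀ s ∈ Set.Icc 0 (dist p q), dist (γ r) (γ s) = |r - s|) ∧
    ∀ α : Path p q, Function.Injective α → Set.range α = γ '' Set.Icc 0 (dist p q)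

/-- A path on `[0,1]` is tree-like if it is `ψ ∘ φ` with a continuous loop `φ` in some `ℝ`-tree
and a continuous map `ψ` on that tree. -/
def IsTreeLike {V : Type*} [NormedAddCommGroup V] (g : ℝ → V) : Prop :=
  ∃ (T : Type u) (_ : MetricSpace T) (φ : C(unitInterval, T)) (ψ : C(T, V)),
    IsRealTree T ∧ φ 0 = φ 1 ∧ ∀ t : unitInterval, g t = ψ (φ t)

end

end MappingSpaceSignature

/-! Since the `j`-th partial derivative of `x` is the derivative of `g j`, the Leibniz formula turns
each Jacobian minor into a signed sum of products of one-variable functions. Multiplying out the `m`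
minors and applying Fubini to the columns of `t` gives the signature formula. Lipschitz bounds on
domains of finite volume give absolute convergence.

For the vanishing it suffices that a tree-like path has zero signature in every level `m ≥ 1`. Let
`φ` be the loop in the tree and `h` a coordinate of the path. If `A` is closed and convex in the
tree, `φ` can leave `A` only to come back at the same point, so the integral of `h'` over the times
spent in `A` is zero (`IsArcSystem.setIntegral_deriv_eq_zero`). Such sets form a π-system that
contains the closed balls, so the positive and negative parts of `h' dt` have the same image under
`φ`. Hence `∫ f h' = 0` for every continuous `f` that factors through `φ`
(`IsArcSystem.intervalIntegral_mul_deriv_eq_zero`). Applied to all `[s, t]` with `φ s = φ t`, this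
shows by induction that iterated integrals factor through `φ` too
(`IsArcSystem.iteratedIntegral_factorsThrough`). Their value at `1` is therefore their value at `0`,
which is zero. -/

namespace MappingSpaceSignature

open Filter Topology

/-! ### Arcs and convex sets in an `ℝ`-tree. -/

section RealTree

variable {T : Type*} [MetricSpace T]

/-- `S p q` is, for all `p` and `q`, a geodesic segment from `p` to `q` and the only arc from `p`
to `q`. -/
structure IsArcSystem (S : T → T → Set T) : Prop where
  geodesic : ∀ p q, ∃ γ : ℝ → T, γ 0 = p ∧ γ (dist p q) = q ∧
    (∀ r ∈ Set.Icc 0 (dist p q), ∀ s ∈ Set.Icc 0 (dist p q), dist (γ r) (γ s) = |r - s|) ∧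
    S p q = γ '' Set.Icc 0 (dist p q)
  unique : ∀ p q, ∀ α : Path p q, Function.Injective α → Set.range α = S p q

theorem IsRealTree.exists_isArcSystem (h : IsRealTree T) : ∃ S : T → T → Set T, IsArcSystem S := by
  choose γ h0 h1 h2 h3 using h
  exact ⟨fun p q => γ p q '' Set.Icc 0 (dist p q),
    fun p q => ⟨γ p q, h0 p q, h1 p q, h2 p q, rfl⟩, h3⟩

namespace IsArcSystem

variable {S : T → T → Set T} (hS : IsArcSystem S)
include hS

theorem image_eq {β : ℝ → T} {L : ℝ} (hL : 0 < L) (hc : ContinuousOn β (Set.Icc 0 L))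
    (hi : Set.InjOn β (Set.Icc 0 L)) : β '' Set.Icc 0 L = S (β 0) (β L) := by
  have hmem : ∀ t : unitInterval, (t : ℝ) * L ∈ Set.Icc 0 L := fun t =>
    ⟨mul_nonneg t.2.1 hL.le, mul_le_of_le_one_left hL.le t.2.2⟩
  let α : Path (β 0) (β L) :=
    { toFun := fun t => β (t * L)
      continuous_toFun := by
        refine hc.comp_continuous (by fun_prop) hmem
      source' := by simp
      target' := by simp }
  rw [← hS.unique _ _ α ?_]
  · ext z
    constructor
    · rintro ⟨t, ht, rfl⟩
      refine ⟨⟨t / L, div_nonneg ht.1 hL.le, (div_le_one hL).2 ht.2⟩, ?_⟩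
      change β (t / L * L) = β t
      rw [div_mul_cancel₀ _ hL.ne']
    · rintro ⟨t, rfl⟩
      exact ⟨t * L, hmem t, rfl⟩
  · intro s t hst
    have := hi (hmem s) (hmem t) hst
    exact Subtype.ext (mul_right_cancel₀ hL.ne' this)

theorem dist_add_dist {p q z : T} (hz : z ∈ S p q) : dist p z + dist z q = dist p q := by
  obtain ⟨γ, h0, h1, h2, h3⟩ := hS.geodesic p q
  rw [h3] at hz
  obtain ⟨s, hs, rfl⟩ := hz
  have a := h2 0 ⟨le_rfl, dist_nonneg⟩ s hs
  have b := h2 s hs (dist p q) ⟨dist_nonneg, le_rfl⟩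
  rw [h0] at a
  rw [h1] at b
  rw [a, b, abs_of_nonpos (by linarith [hs.1]), abs_of_nonpos (by linarith [hs.2])]
  ring

theorem left_mem (p q : T) : p ∈ S p q := by
  obtain ⟨γ, h0, h1, h2, h3⟩ := hS.geodesic p q
  rw [h3]
  exact ⟨0, ⟨le_rfl, dist_nonneg⟩, h0⟩

theorem exists_mem_ne {p q : T} (hpq : p ≠ q) : ∃ z ∈ S p q, z ≠ p ∧ z ≠ q := by
  obtain ⟨γ, h0, h1, h2, h3⟩ := hS.geodesic p q
  have hd : 0 < dist p q := dist_pos.2 hpq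
  have hm : dist p q / 2 ∈ Set.Icc 0 (dist p q) := ⟨by linarith, by linarith⟩
  refine ⟨γ (dist p q / 2), h3 ▸ ⟨_, hm, rfl⟩, fun h => ?_, fun h => ?_⟩
  · have a := h2 _ hm 0 ⟨le_rfl, hd.le⟩
    rw [h0, h, dist_self, sub_zero, abs_of_pos (by linarith)] at a
    linarith
  · have a := h2 _ hm _ ⟨hd.le, le_rfl⟩
    rw [h1, h, dist_self, abs_of_neg (by linarith)] at a
    linarith

theorem isClosed (p q : T) : IsClosed (S p q) := by
  obtain ⟨γ, h0, h1, h2, h3⟩ := hS.geodesic p q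
  rw [h3]
  refine (isCompact_Icc.image_of_continuousOn ?_).isClosed
  have : LipschitzOnWith 1 γ (Set.Icc 0 (dist p q)) := LipschitzOnWith.of_dist_le_mul fun r hr s hs => by
    rw [h2 r hr s hs, NNReal.coe_one, one_mul, Real.dist_eq]
  exact this.continuousOn

/-- Follow the geodesic from `p` to `r` up to its first point on `S r q`, then continue along `S r
q` to `q`. The concatenation is injective, so by uniqueness it is the arc from `p` to `q`. -/
theorem subset_union (p q r : T) : S p q ⊆ S p r ∪ S r q := by
  -- The concatenation may have length zero when `p = q`, and `image_eq` needs positive length.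
  rcases eq_or_ne p q with rfl | hpq
  · intro z hz
    have := hS.dist_add_dist hz
    rw [dist_self, dist_comm z] at this
    have hz : dist p z = 0 := by linarith [dist_nonneg (x := p) (y := z)]
    rw [← dist_eq_zero.1 hz]
    exact Or.inl (hS.left_mem _ _)
  obtain ⟨γ, h0, h1, h2, h3⟩ := hS.geodesic p r
  obtain ⟨δ, k0, k1, k2, k3⟩ := hS.geodesic r q
  have hγ : ContinuousOn γ (Set.Icc 0 (dist p r)) := by
    have : LipschitzOnWith 1 γ (Set.Icc 0 (dist p r)) :=
      LipschitzOnWith.of_dist_le_mul fun x hx y hy => by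
        rw [h2 x hx y hy, NNReal.coe_one, one_mul, Real.dist_eq]
    exact this.continuousOn
  have hδ : ContinuousOn δ (Set.Icc 0 (dist r q)) := by
    have : LipschitzOnWith 1 δ (Set.Icc 0 (dist r q)) :=
      LipschitzOnWith.of_dist_le_mul fun x hx y hy => by
        rw [k2 x hx y hy, NNReal.coe_one, one_mul, Real.dist_eq]
    exact this.continuousOn
  have hγi : ∀ x ∈ Set.Icc 0 (dist p r), ∀ y ∈ Set.Icc 0 (dist p r), γ x = γ y → x = y := by
    intro x hx y hy h
    have := h2 x hx y hy
    rw [h, dist_self, eq_comm, abs_eq_zero] at this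
    linarith
  have hδi : ∀ x ∈ Set.Icc 0 (dist r q), ∀ y ∈ Set.Icc 0 (dist r q), δ x = δ y → x = y := by
    intro x hx y hy h
    have := k2 x hx y hy
    rw [h, dist_self, eq_comm, abs_eq_zero] at this
    linarith
  obtain ⟨s, ⟨hs, hsr⟩, hmin⟩ : ∃ s, IsLeast (Set.Icc 0 (dist p r) ∩ γ ⁻¹' S r q) s := by
    refine IsCompact.exists_isLeast ?_ ⟨dist p r, ⟨dist_nonneg, le_rfl⟩, ?_⟩
    · exact isCompact_Icc.of_isClosed_subset
        (hγ.preimage_isClosed_of_isClosed isClosed_Icc (hS.isClosed r q)) Set.inter_subset_left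
    · rw [Set.mem_preimage, h1]; exact hS.left_mem r q
  rw [Set.mem_preimage, k3] at hsr
  obtain ⟨u, hu, hus⟩ := hsr
  set L := s + (dist r q - u) with hL
  let β : ℝ → T := fun x => if x ≤ s then γ x else δ (x - s + u)
  have hβ0 : β 0 = p := by simp [β, hs.1, h0]
  have hβL : β L = q := by
    by_cases h : L ≤ s
    · have : u = dist r q := le_antisymm hu.2 (by linarith)
      have hLs : L = s := by rw [hL, this]; ring
      simp only [β, h, if_true]
      rw [hLs, ← hus, this, k1]
    · simp only [β, h, if_false]
      rw [← k1]; congr 1; rw [hL]; ring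
  have hLs : s ≤ L := by linarith [hu.2]
  have hLpos : 0 < L := by
    rcases (hs.1.trans hLs).eq_or_lt with h | h
    · exact absurd (by rw [← hβ0, ← hβL, ← h]) hpq
    · exact h
  have hβ1 : ∀ x ∈ Set.Icc 0 s, β x = γ x := fun x hx => by simp [β, hx.2]
  have hβ2 : ∀ x ∈ Set.Icc s L, β x = δ (x - s + u) := fun x hx => by
    rcases hx.1.eq_or_lt with h | h
    · subst h; simp [β, hus]
    · simp [β, h]
  have hm2 : ∀ x ∈ Set.Icc s L, x - s + u ∈ Set.Icc 0 (dist r q) := fun x hx =>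
    ⟨by linarith [hx.1, hu.1], by linarith [hx.2]⟩
  have hm1 : ∀ x ∈ Set.Icc 0 s, x ∈ Set.Icc 0 (dist p r) := fun x hx => ⟨hx.1, hx.2.trans hs.2⟩
  have key := hS.image_eq (β := β) hLpos ?_ ?_
  · rw [hβ0, hβL] at key
    rw [← key]
    rintro _ ⟨x, hx, rfl⟩
    rcases le_total x s with h | h
    · left
      rw [hβ1 x ⟨hx.1, h⟩, h3]
      exact ⟨x, hm1 x ⟨hx.1, h⟩, rfl⟩
    · right
      rw [hβ2 x ⟨h, hx.2⟩, k3]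
      exact ⟨_, hm2 x ⟨h, hx.2⟩, rfl⟩
  · rw [← Set.Icc_union_Icc_eq_Icc hs.1 hLs]
    refine ContinuousOn.union_of_isClosed ?_ ?_ isClosed_Icc isClosed_Icc
    · exact (hγ.mono hm1).congr hβ1
    · refine ContinuousOn.congr ?_ hβ2
      exact hδ.comp (by fun_prop) hm2
  -- The two pieces cannot meet before time `s`, because `s` is the first hitting time of `S r q`.
  · have cross : ∀ x ∈ Set.Icc 0 L, ∀ y ∈ Set.Icc 0 L, x < s → s ≤ y → β x ≠ β y := by
      intro x hx y hy hxs hsy h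
      rw [hβ1 x ⟨hx.1, hxs.le⟩, hβ2 y ⟨hsy, hy.2⟩] at h
      refine absurd (hmin ⟨hm1 x ⟨hx.1, hxs.le⟩, ?_⟩) (not_le.2 hxs)
      rw [Set.mem_preimage, k3]
      exact ⟨_, hm2 y ⟨hsy, hy.2⟩, h.symm⟩
    intro x hx y hy h
    rcases lt_or_ge x s with hxs | hxs <;> rcases lt_or_ge y s with hys | hys
    · rw [hβ1 x ⟨hx.1, hxs.le⟩, hβ1 y ⟨hy.1, hys.le⟩] at h
      exact hγi x (hm1 x ⟨hx.1, hxs.le⟩) y (hm1 y ⟨hy.1, hys.le⟩) h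
    · exact absurd h (cross x hx y hy hxs hys)
    · exact absurd h.symm (cross y hy x hx hys hxs)
    · rw [hβ2 x ⟨hxs, hx.2⟩, hβ2 y ⟨hys, hy.2⟩] at h
      have := hδi _ (hm2 x ⟨hxs, hx.2⟩) _ (hm2 y ⟨hys, hy.2⟩) h
      linarith

/-- Segments between nearby values of `φ` are too short to reach `z`, and by `subset_union` avoiding
`z` is a transitive relation; connectedness makes it global. -/
theorem notMem_of_isPreconnected {φ : ℝ → T} (hφ : Continuous φ) {I : Set ℝ}
    (hI : IsPreconnected I) {z : T} (hz : ∀ t ∈ I, φ t ≠ z) {a b : ℝ} (ha : a ∈ I) (hb : b ∈ I) :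
    z ∉ S (φ a) (φ b) := by
  -- Both orders are carried along so that the relation is visibly symmetric, without proving `S p q
  -- = S q p`.
  have := hI.induction₂ (fun s t => z ∉ S (φ s) (φ t) ∧ z ∉ S (φ t) (φ s)) ?_ ?_ ?_ ha hb
  · exact this.1
  · intro t ht
    have hpos : 0 < dist (φ t) z := dist_pos.2 (hz t ht)
    have := (hφ.tendsto t).eventually (Metric.ball_mem_nhds _ hpos)
    refine (this.filter_mono nhdsWithin_le_nhds).mono fun s hs => ?_
    change dist (φ s) (φ t) < dist (φ t) z at hs
    refine ⟨fun h => ?_, fun h => ?_⟩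
    · have := hS.dist_add_dist h
      rw [dist_comm] at hs
      linarith [dist_nonneg (x := z) (y := φ s)]
    · have := hS.dist_add_dist h
      rw [dist_comm z] at this
      linarith [dist_nonneg (x := z) (y := φ s), dist_nonneg (x := φ s) (y := z)]
  · intro x y z' _ _ _ h h'
    exact ⟨fun hh => (hS.subset_union _ _ (φ y) hh).elim h.1 h'.1,
      fun hh => (hS.subset_union _ _ (φ y) hh).elim h'.2 h.2⟩
  · intro x y _ _ h
    exact h.symm

/-- A path outside a convex set that leaves it at `φ a` and comes back at `φ b` does so at the
same point. -/
theorem eq_of_excursion {φ : ℝ → T} (hφ : Continuous φ) {A : Set T}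
    (hA : ∀ p ∈ A, ∀ q ∈ A, S p q ⊆ A) {a b : ℝ} (hab : a ≤ b) (ha : φ a ∈ A) (hb : φ b ∈ A)
    (h : ∀ t ∈ Set.Ioo a b, φ t ∉ A) : φ a = φ b := by
  by_contra hne
  -- An inner point `z` of the segment lies in `A` by convexity, so the excursion never visits it,
  -- although a path joining the two ends must.
  obtain ⟨z, hz, hza, hzb⟩ := hS.exists_mem_ne hne
  refine hS.notMem_of_isPreconnected hφ (isPreconnected_Icc (a := a) (b := b)) (fun t ht e => ?_)
    (Set.left_mem_Icc.2 hab) (Set.right_mem_Icc.2 hab) hz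
  rcases ht.1.eq_or_lt with rfl | h1
  · exact hza e.symm
  rcases ht.2.eq_or_lt with rfl | h2
  · exact hzb e.symm
  exact h t ⟨h1, h2⟩ (e ▸ hA _ ha _ hb hz)

/-- For a loop on `[a, b]`, the excursion may go through the base point. -/
theorem eq_of_excursion_through_endpoints {φ : ℝ → T} (hφ : Continuous φ) {A : Set T}
    (hA : ∀ p ∈ A, ∀ q ∈ A, S p q ⊆ A) {a b c d : ℝ} (hac : a ≤ c) (hdb : d ≤ b)
    (hab : φ a = φ b) (hc : φ c ∈ A) (hd : φ d ∈ A)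
    (h1 : ∀ t ∈ Set.Ico a c, φ t ∉ A) (h2 : ∀ t ∈ Set.Ioc d b, φ t ∉ A) : φ c = φ d := by
  by_contra hne
  obtain ⟨z, hz, hzc, hzd⟩ := hS.exists_mem_ne hne
  have hzA : z ∈ A := hA _ hc _ hd hz
  have e1 := hS.notMem_of_isPreconnected hφ (isPreconnected_Icc (a := a) (b := c)) (z := z)
    (fun t ht e => ?_) (Set.right_mem_Icc.2 hac) (Set.left_mem_Icc.2 hac)
  · have e2 := hS.notMem_of_isPreconnected hφ (isPreconnected_Icc (a := d) (b := b)) (z := z)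
      (fun t ht e => ?_) (Set.right_mem_Icc.2 hdb) (Set.left_mem_Icc.2 hdb)
    · rw [← hab] at e2
      exact (hS.subset_union _ _ _ hz).elim e1 e2
    · rcases ht.1.eq_or_lt with rfl | h
      · exact hzd e.symm
      · exact h2 t ⟨h, ht.2⟩ (e ▸ hzA)
  · rcases ht.2.eq_or_lt with rfl | h
    · exact hzc e.symm
    · exact h1 t ⟨ht.1, h⟩ (e ▸ hzA)

theorem closedBall_convex (c : T) (r : ℝ) :
    ∀ p ∈ Metric.closedBall c r, ∀ q ∈ Metric.closedBall c r, S p q ⊆ Metric.closedBall c r := by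
  intro p hp q hq z hz
  rw [Metric.mem_closedBall] at *
  rcases hS.subset_union p q c hz with h | h
  · have := hS.dist_add_dist h
    linarith [dist_nonneg (x := p) (y := z)]
  · have := hS.dist_add_dist h
    rw [dist_comm c z, dist_comm c q] at this
    linarith [dist_nonneg (x := z) (y := q)]

end IsArcSystem

end RealTree

/-! ### The integral of a derivative over the times spent in a convex set. -/

theorem countable_setOf_not_accPt {X : Type*} [TopologicalSpace X] [SecondCountableTopology X]
    (F : Set X) : {t | t ∈ F ∧ ¬AccPt t (𝓟 F)}.Countable := by
  refine IsLindelof.countable (HereditarilyLindelofSpace.isLindelof _) ?_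
  rw [discreteTopology_subtype_iff]
  rintro t ⟨_, h⟩
  rw [AccPt, neBot_iff, not_not] at h
  exact le_bot_iff.1 (h ▸ inf_le_inf_left _ (principal_mono.2 fun _ hx => hx.1))

/-- Freeze `h` during the excursions of `φ` from `A`. The frozen function is still Lipschitz because
each excursion returns to its starting point. Its derivative is `h'` a.e. on `F` and zero off `F`,
and its values at `a` and `b` agree, so the fundamental theorem of calculus applies. -/
theorem IsArcSystem.setIntegral_deriv_eq_zero {T : Type*} [MetricSpace T]
    {S : T → T → Set T} (hS : IsArcSystem S) {φ : ℝ → T}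
    (hφ : Continuous φ) {h : ℝ → ℝ} {K : NNReal} (hh : LipschitzWith K h)
    (hf : ∀ s t, φ s = φ t → h s = h t) {a b : ℝ} (hab : a ≤ b) (hφab : φ a = φ b)
    {A : Set T} (hAc : IsClosed A) (hA : ∀ p ∈ A, ∀ q ∈ A, S p q ⊆ A) :
    ∫ t in Set.Icc a b ∩ φ ⁻¹' A, deriv h t = 0 := by
  set F := Set.Icc a b ∩ φ ⁻¹' A with hF
  have hFc : IsClosed F := isClosed_Icc.inter (hAc.preimage hφ)
  have hFk : IsCompact F := isCompact_Icc.inter_right (hAc.preimage hφ)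
  rcases F.eq_empty_or_nonempty with he | hne
  · rw [he]; simp
  obtain ⟨c, hc⟩ := hFk.exists_isLeast hne
  have hcab : c ∈ Set.Icc a b := hc.1.1
  -- `p t` is the last time in `F` up to `t`; the maximum with `c` makes it equal to the first time
  -- `c` for earlier `t`.
  have hp : ∀ t, ∃ p, IsGreatest (F ∩ Set.Iic (max t c)) p := fun t =>
    (hFk.inter_right isClosed_Iic).exists_isGreatest ⟨c, hc.1, Set.mem_Iic.2 (le_max_right _ _)⟩
  choose p hp using hp
  have hpm : ∀ t, p t ∈ F := fun t => (hp t).1.1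
  have hple : ∀ t, p t ≤ max t c := fun t => (hp t).1.2
  have hpmax : ∀ t, ∀ u ∈ F, u ≤ max t c → u ≤ p t := fun t u hu hut => (hp t).2 ⟨hu, hut⟩
  have hpF : ∀ t ∈ F, p t = t := fun t ht =>
    le_antisymm ((hple t).trans (max_le le_rfl (hc.2 ht))) (hpmax t t ht (le_max_left _ _))
  have hplow : ∀ t ≤ c, p t = c := fun t ht =>
    le_antisymm ((hple t).trans (max_le ht le_rfl)) (hc.2 (hpm t))
  have hpc : ∀ t, c ≤ p t := fun t => hc.2 (hpm t)
  have hpmono : Monotone p := fun s t hst =>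
    hpmax t _ (hpm s) ((hple s).trans (max_le_max_right _ hst))
  -- Here `e` is the next time in `F` from `s` on. Replacing `p s` by `e` gives `s ≤ e ≤ p t ≤ t` in
  -- the Lipschitz estimate, so the constant `K` is kept.
  have hnext : ∀ s e, e ∈ F → s ≤ e → (∀ t ∈ F, s ≤ t → e ≤ t) → h (p s) = h e := by
    intro s e he hse hnot
    rcases le_total s c with hsc | hsc
    · rw [hplow s hsc, le_antisymm (hc.2 he) (hnot c hc.1 hsc)]
    · have hps : p s ≤ s := (hple s).trans (max_le le_rfl hsc)
      refine hf _ _ (hS.eq_of_excursion hφ hA (hps.trans hse) (hpm s).2 he.2 fun t ht htA => ?_)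
      have htF : t ∈ F := ⟨⟨(hpm s).1.1.trans ht.1.le, ht.2.le.trans he.1.2⟩, htA⟩
      rcases le_total s t with h1 | h1
      · exact absurd (hnot t htF h1) (not_le.2 ht.2)
      · exact absurd (hpmax s t htF (h1.trans (le_max_left _ _))) (not_le.2 ht.1)
  have hLip : LipschitzWith K (fun t => h (p t)) := by
    refine LipschitzWith.of_dist_le_mul fun s t => ?_
    wlog hst : s ≤ t generalizing s t
    · rw [dist_comm, dist_comm s]; exact this t s (le_of_not_ge hst)
    by_cases hcase : p t ≤ max s c
    · have : p s = p t := le_antisymm (hpmono hst) (hpmax s _ (hpm t) hcase)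
      rw [this, dist_self]; positivity
    · rw [not_le, max_lt_iff] at hcase
      have hpt : p t ≤ t := by
        rcases le_max_iff.1 (hple t) with h1 | h1
        · exact h1
        · exact absurd h1 (not_le.2 hcase.2)
      obtain ⟨e, he⟩ := (hFk.inter_right (isClosed_Ici (a := s))).exists_isLeast
        ⟨p t, (hpm t), hcase.1.le⟩
      have hept : e ≤ p t := he.2 ⟨(hpm t), hcase.1.le⟩
      rw [hnext s e he.1.1 he.1.2 fun u hu hsu => he.2 ⟨hu, hsu⟩]
      refine (hh.dist_le_mul _ _).trans (mul_le_mul_of_nonneg_left ?_ K.2)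
      rw [Real.dist_eq, Real.dist_eq, abs_of_nonpos (by linarith), abs_of_nonpos (by linarith)]
      have : s ≤ e := he.1.2
      linarith
  -- The stretches before `c` and after `p b` form one excursion through the base point of the loop.
  have hends : h (p b) = h (p a) := by
    rw [hplow a hcab.1]
    refine (hf _ _ ?_).symm
    refine hS.eq_of_excursion_through_endpoints hφ hA hcab.1 (hpm b).1.2 hφab hc.1.2
      (hpm b).2 (fun t ht htA => ?_) (fun t ht htA => ?_)
    · exact absurd (hc.2 ⟨⟨ht.1, ht.2.le.trans hcab.2⟩, htA⟩) (not_le.2 ht.2)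
    · exact absurd (hpmax b t ⟨⟨hcab.1.trans ((hpc b).trans ht.1.le), ht.2⟩, htA⟩
        (ht.2.trans (le_max_left _ _))) (not_le.2 ht.1)
  have hftc : ∫ t in a..b, deriv (fun t => h (p t)) t = 0 := by
    rw [(hLip.lipschitzOnWith (s := Set.uIcc a b)).absolutelyContinuousOnInterval
      |>.integral_deriv_eq_sub, hends, sub_self]
  rw [intervalIntegral.integral_of_le hab, ← integral_Icc_eq_integral_Ioc] at hftc
  have hind : ∫ t in F, deriv h t = ∫ t in Set.Icc a b, F.indicator (deriv h) t := by
    rw [setIntegral_indicator hFc.measurableSet,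
      Set.inter_eq_right.2 (Set.inter_subset_left : F ⊆ Set.Icc a b)]
  rw [← hftc, hind]
  refine setIntegral_congr_ae measurableSet_Icc ?_
  filter_upwards [hLip.ae_differentiableAt_real, hh.ae_differentiableAt_real,
    (countable_setOf_not_accPt F).ae_notMem volume] with t h1 h2 h3 _
  by_cases ht : t ∈ F
  · rw [Set.indicator_of_mem ht]
    -- At an accumulation point of `F`, the derivative is determined by the values on `F`, where `h
    -- ∘ p` and `h` agree. The countably many isolated points have been discarded.
    have hacc : UniqueDiffWithinAt ℝ F t := by
      rw [uniqueDiffWithinAt_iff_accPt]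
      by_contra hcon
      exact h3 ⟨ht, hcon⟩
    rw [← h1.derivWithin hacc, ← h2.derivWithin hacc]
    exact (derivWithin_congr (fun s hs => by rw [hpF s hs]) (by rw [hpF t ht])).symm
  · rw [Set.indicator_of_notMem ht]
    obtain ⟨δ, hδ, hδF⟩ := Metric.mem_nhds_iff.1 (hFc.isOpen_compl.mem_nhds ht)
    have : (fun s => h (p s)) =ᶠ[𝓝 t] fun _ => h (p t) := by
      filter_upwards [Metric.ball_mem_nhds t hδ] with s hs
      have key : ∀ x ∈ Metric.ball t δ, ∀ y ∈ Metric.ball t δ, p x ≤ p y := by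
        intro x hx y hy
        refine hpmax y _ (hpm x) ?_
        rcases le_max_iff.1 (hple x) with hle | hle
        · by_contra hcon
          rw [not_le, max_lt_iff] at hcon
          refine hδF ?_ (hpm x)
          rw [Real.ball_eq_Ioo] at *
          exact ⟨hy.1.trans hcon.1, hle.trans_lt hx.2⟩
        · exact hle.trans (le_max_right _ _)
      rw [le_antisymm (key s hs t (Metric.mem_ball_self hδ)) (key t (Metric.mem_ball_self hδ) s hs)]
    rw [this.deriv_eq, deriv_const]

/-! ### From convex sets to continuous integrands that factor through the tree. -/

theorem isPiSystem_closed_convex {T : Type*} [TopologicalSpace T] (S : T → T → Set T) (X : Set T) :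
    IsPiSystem {B : Set X | ∃ A : Set T, IsClosed A ∧ (∀ p ∈ A, ∀ q ∈ A, S p q ⊆ A) ∧
      B = Subtype.val ⁻¹' A} := by
  rintro _ ⟨A, hAc, hA, rfl⟩ _ ⟨B, hBc, hB, rfl⟩ _
  exact ⟨A ∩ B, hAc.inter hBc, fun p hp q hq =>
    Set.subset_inter (hA p hp.1 q hq.1) (hB p hp.2 q hq.2), rfl⟩

theorem borel_eq_generateFrom_closedBall {X : Type*} [PseudoMetricSpace X]
    [SecondCountableTopology X] {C : Set (Set X)} (hC : ∀ B ∈ C, IsClosed B)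
    (hball : ∀ c r, Metric.closedBall c r ∈ C) : borel X = MeasurableSpace.generateFrom C := by
  refine le_antisymm (MeasurableSpace.generateFrom_le fun U hU => ?_) ?_
  · have : ∀ x ∈ U, ∃ r > 0, Metric.closedBall x r ⊆ U := fun x hx =>
      Metric.nhds_basis_closedBall.mem_iff.1 (IsOpen.mem_nhds hU hx)
    choose! r hr hrU using this
    obtain ⟨t, htU, ht, hcov⟩ := TopologicalSpace.countable_cover_nhdsWithin
      (f := fun x => Metric.closedBall x (r x)) (s := U)
      fun x hx => mem_nhdsWithin_of_mem_nhds (Metric.closedBall_mem_nhds x (hr x hx))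
    rw [show U = ⋃ x ∈ t, Metric.closedBall x (r x) from
      Set.Subset.antisymm hcov (Set.iUnion₂_subset fun x hx => hrU x (htU hx))]
    exact MeasurableSet.biUnion ht fun x _ => MeasurableSpace.measurableSet_generateFrom (hball _ _)
  · refine MeasurableSpace.generateFrom_le fun B hB => ?_
    let := borel X
    have : BorelSpace X := ⟨rfl⟩
    exact (hC B hB).measurableSet

theorem integrableOn_deriv_of_lipschitzWith {h : ℝ → ℝ} {K : NNReal} (hh : LipschitzWith K h)
    {s : Set ℝ} (hs : volume s ≠ ⊤) : IntegrableOn (deriv h) s :=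
  Measure.integrableOn_of_bounded hs (measurable_deriv h).aestronglyMeasurable
    (Eventually.of_forall fun _ => norm_deriv_le_of_lipschitz hh)

theorem lintegral_ofReal_eq_of_integral_eq_zero {α : Type*} [MeasurableSpace α] {μ : Measure α}
    {k : α → ℝ} (hk : Integrable k μ) (h : ∫ t, k t ∂μ = 0) :
    ∫⁻ t, ENNReal.ofReal (k t) ∂μ = ∫⁻ t, ENNReal.ofReal (-k t) ∂μ := by
  rw [integral_eq_lintegral_pos_part_sub_lintegral_neg_part hk, sub_eq_zero] at h
  have fin : ∀ {k' : α → ℝ}, Integrable k' μ → ∫⁻ t, ENNReal.ofReal (k' t) ∂μ ≠ ⊤ := fun hk' =>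
    ((lintegral_mono fun t => Real.ofReal_le_enorm _).trans_lt hk'.2).ne
  exact (ENNReal.toReal_eq_toReal_iff' (fin hk) (fin hk.neg)).1 h

theorem IsArcSystem.intervalIntegral_mul_deriv_eq_zero {T : Type*} [MetricSpace T]
    {S : T → T → Set T} (hS : IsArcSystem S) {φ : ℝ → T}
    (hφ : Continuous φ) {h f : ℝ → ℝ} {K : NNReal} (hh : LipschitzWith K h)
    (hhφ : ∀ s t, φ s = φ t → h s = h t) (hf : Continuous f) (hfφ : ∀ s t, φ s = φ t → f s = f t)
    {a b : ℝ} (hab : a ≤ b) (hφab : φ a = φ b) :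
    ∫ t in a..b, f t * deriv h t = 0 := by
  -- The tree need not be separable. The compact image `X` is second countable, so balls generate
  -- its Borel sets, and it is a quotient of `[a, b]`, so `f` descends to a continuous `G`.
  let X := Set.range fun t : Set.Icc a b => φ t
  let ψ : Set.Icc a b → X := Set.rangeFactorization _
  have hψ : Continuous ψ := by
    refine Continuous.subtype_mk ?_ _
    exact hφ.comp continuous_subtype_val
  have hψs : Function.Surjective ψ := Set.rangeFactorization_surjective
  have : CompactSpace X := isCompact_iff_compactSpace.1 (isCompact_range (by fun_prop))
  let : MeasurableSpace X := borel X
  have : BorelSpace X := ⟨rfl⟩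
  let f' : C(Set.Icc a b, ℝ) := ⟨fun t => f t, by fun_prop⟩
  have hf' : Function.FactorsThrough f' ψ := fun s t (hst : ψ s = ψ t) =>
    hfφ s t (congrArg Subtype.val hst)
  let ψ' : C(Set.Icc a b, X) := ⟨ψ, hψ⟩
  have hquot : IsQuotientMap ψ' := hψ.isClosedMap.isQuotientMap hψ hψs
  let G : C(X, ℝ) := hquot.lift f' hf'
  have hG : ∀ t, G (ψ t) = f t := fun t => DFunLike.congr_fun (hquot.lift_comp f' hf') t
  let ρ : ℝ → X := fun t => ψ (Set.projIcc a b hab t)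
  have hρ : Continuous ρ := hψ.comp continuous_projIcc
  have hρφ : ∀ t ∈ Set.Icc a b, (ρ t : T) = φ t := fun t ht => by
    simp only [ρ]; rw [Set.projIcc_of_mem hab ht]; rfl
  have hGf : ∀ t ∈ Set.Icc a b, G (ρ t) = f t := fun t ht => by
    simp only [ρ]; rw [hG, Set.projIcc_of_mem hab ht]
  have hint : IntegrableOn (deriv h) (Set.Icc a b) :=
    integrableOn_deriv_of_lipschitzWith hh measure_Icc_lt_top.ne
  let μ : (ℝ → ℝ) → Measure X := fun k =>
    ((volume.restrict (Set.Icc a b)).withDensity fun t => ENNReal.ofReal (k t)).map ρ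
  have hμA : ∀ (k : ℝ → ℝ) (B : Set X), MeasurableSet B →
      μ k B = ∫⁻ t in Set.Icc a b ∩ ρ ⁻¹' B, ENNReal.ofReal (k t) := by
    intro k B hB
    have hB' := hρ.measurable hB
    rw [Measure.map_apply hρ.measurable hB, withDensity_apply _ hB',
      Measure.restrict_restrict hB', Set.inter_comm]
  have hfin : ∀ k : ℝ → ℝ, IntegrableOn k (Set.Icc a b) → IsFiniteMeasure (μ k) := by
    intro k hk
    have := isFiniteMeasure_withDensity_ofReal hk.2
    infer_instance
  have := hfin _ hint
  have := hfin _ hint.neg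
  have hclosed : ∀ A : Set T, IsClosed A → (∀ p ∈ A, ∀ q ∈ A, S p q ⊆ A) →
      μ (deriv h) (Subtype.val ⁻¹' A) = μ (-deriv h) (Subtype.val ⁻¹' A) := by
    intro A hAc hA
    have hm : MeasurableSet (Subtype.val ⁻¹' A : Set X) :=
      (hAc.preimage continuous_subtype_val).measurableSet
    rw [hμA _ _ hm, hμA _ _ hm]
    have hset : Set.Icc a b ∩ ρ ⁻¹' (Subtype.val ⁻¹' A) = Set.Icc a b ∩ φ ⁻¹' A := by
      ext t
      refine and_congr_right fun ht => ?_
      simp only [Set.mem_preimage]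
      rw [hρφ t ht]
    rw [hset]
    exact lintegral_ofReal_eq_of_integral_eq_zero (hint.mono_set Set.inter_subset_left)
      (hS.setIntegral_deriv_eq_zero hφ hh hhφ hab hφab hAc hA)
  -- `ENNReal.ofReal` truncates at zero, so these are the images of the positive and negative parts
  -- of `h' dt`. The π-λ theorem applies; the case `A = Set.univ` gives equal total mass.
  have hμ : μ (deriv h) = μ (-deriv h) := by
    refine ext_of_generate_finite _ (borel_eq_generateFrom_closedBall ?_ ?_)
      (isPiSystem_closed_convex S X) ?_ ?_
    · rintro _ ⟨A, hAc, -, rfl⟩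
      exact hAc.preimage continuous_subtype_val
    · exact fun c r => ⟨Metric.closedBall c r, Metric.isClosed_closedBall,
        hS.closedBall_convex _ _, rfl⟩
    · rintro _ ⟨A, hAc, hA, rfl⟩
      exact hclosed A hAc hA
    · exact hclosed Set.univ isClosed_univ fun _ _ _ _ => Set.subset_univ _
  have hGμ : ∀ k : ℝ → ℝ, Measurable k →
      ∫ y, G y ∂μ k = ∫ t in Set.Icc a b, max (k t) 0 * f t := by
    intro k hk
    rw [integral_map hρ.measurable.aemeasurable G.continuous.aestronglyMeasurable,
      integral_withDensity_eq_integral_toReal_smul hk.ennreal_ofReal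
        (Eventually.of_forall fun _ => ENNReal.ofReal_lt_top)]
    refine setIntegral_congr_fun measurableSet_Icc fun t ht => ?_
    simp only [ENNReal.toReal_ofReal', smul_eq_mul, hGf t ht]
  have h1 := hGμ _ (measurable_deriv h)
  rw [hμ, hGμ _ (measurable_deriv h).neg] at h1
  rw [intervalIntegral.integral_of_le hab, ← integral_Icc_eq_integral_Ioc]
  have hi : ∀ k : ℝ → ℝ, IntegrableOn k (Set.Icc a b) →
      IntegrableOn (fun t => max (k t) 0 * f t) (Set.Icc a b) := fun k hk => by
    have hk' : IntegrableOn (fun t => max (k t) 0) (Set.Icc a b) := Integrable.pos_part hk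
    exact hk'.mul_continuousOn hf.continuousOn isCompact_Icc
  rw [← sub_eq_zero, ← integral_sub (hi _ hint.neg) (hi _ hint), ← neg_eq_zero, ← integral_neg] at h1
  rw [← h1]
  refine integral_congr_ae (Eventually.of_forall fun t => ?_)
  simp only [Pi.neg_apply]
  rcases le_total (deriv h t) 0 with hd | hd
  · rw [max_eq_right hd, max_eq_left (by linarith)]; ring
  · rw [max_eq_left hd, max_eq_right (by linarith)]; ring

/-! ### Iterated integrals and integrals over simplices. -/

/-- The iterated integral `∫ k₁(t₁) ⋯ k_m(t_m)` over `0 < t₁ < ⋯ < t_m < t`. -/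
noncomputable def iteratedIntegral : (m : ℕ) → (Fin m → ℝ → ℝ) → ℝ → ℝ
  | 0, _, _ => 1
  | m + 1, k, t => ∫ u in (0 : ℝ)..t,
      iteratedIntegral m (fun i => k i.castSucc) u * k (Fin.last m) u

theorem intervalIntegrable_of_abs_le {k : ℝ → ℝ} (hk : Measurable k) {C : ℝ}
    (hC : ∀ t, |k t| ≤ C) (a b : ℝ) : IntervalIntegrable k volume a b := by
  rw [intervalIntegrable_iff]
  exact Measure.integrableOn_of_bounded measure_Ioc_lt_top.ne hk.aestronglyMeasurable
    (Eventually.of_forall hC)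

theorem continuous_iteratedIntegral {C : ℝ} : ∀ {m : ℕ} {k : Fin m → ℝ → ℝ},
    (∀ i, Measurable (k i)) → (∀ i t, |k i t| ≤ C) → Continuous (iteratedIntegral m k)
  | 0, _, _, _ => continuous_const
  | _ + 1, _, hk, hC => intervalIntegral.continuous_primitive (fun a b =>
      (intervalIntegrable_of_abs_le (hk _) (hC _) a b).continuousOn_mul
        (continuous_iteratedIntegral (fun i => hk i.castSucc) fun i => hC i.castSucc).continuousOn) 0

/-- The simplex `0 ≤ t₁ < ⋯ < t_m < r`. -/
def halfOpenSimplex (m : ℕ) (r : ℝ) : Set (Fin m → ℝ) :=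
  {t | (∀ i, t i ∈ Set.Ico 0 r) ∧ StrictMono t}

theorem measurableSet_strictMono_comp {m : ℕ} (π : Fin m → Fin m) :
    MeasurableSet {t : Fin m → ℝ | StrictMono fun i => t (π i)} := by
  have : {t : Fin m → ℝ | StrictMono fun i => t (π i)} =
      ⋂ i, ⋂ j, ⋂ _ : i < j, {t | t (π i) < t (π j)} := by
    ext t; simp [StrictMono]
  rw [this]
  exact MeasurableSet.iInter fun i => MeasurableSet.iInter fun j => MeasurableSet.iInter fun _ =>
    measurableSet_lt (measurable_pi_apply _) (measurable_pi_apply _)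

theorem measurableSet_halfOpenSimplex (m : ℕ) (r : ℝ) : MeasurableSet (halfOpenSimplex m r) := by
  have : halfOpenSimplex m r = (Set.univ.pi fun _ => Set.Ico 0 r) ∩
      {t | StrictMono fun i => t (id i)} := by
    ext t; simp [halfOpenSimplex]
  rw [this]
  exact (MeasurableSet.univ_pi fun _ => measurableSet_Ico).inter (measurableSet_strictMono_comp id)

theorem volume_halfOpenSimplex_ne_top (m : ℕ) (r : ℝ) : volume (halfOpenSimplex m r) ≠ ⊤ := by
  refine ((measure_mono (t := Set.univ.pi fun _ => Set.Ico 0 r) fun t ht i _ => ht.1 i).trans_lt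
    ?_).ne
  rw [volume_pi_pi]
  exact ENNReal.prod_lt_top fun i _ => measure_Ico_lt_top

theorem integrableOn_of_abs_le {ι : Type*} [MeasurableSpace ι] {μ : Measure ι} {s : Set ι}
    (hs : μ s ≠ ⊤) {F : ι → ℝ} (hF : Measurable F) {C : ℝ} (hC : ∀ t, |F t| ≤ C) :
    IntegrableOn F s μ :=
  Measure.integrableOn_of_bounded hs hF.aestronglyMeasurable (Eventually.of_forall hC)

theorem abs_prod_le_pow {ι : Type*} [Fintype ι] {f : ι → ℝ} {C : ℝ} (hf : ∀ i, |f i| ≤ C) :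
    |∏ i, f i| ≤ C ^ Fintype.card ι := by
  rw [Finset.abs_prod, ← Finset.card_univ, ← Finset.prod_const]
  exact Finset.prod_le_prod (fun _ _ => abs_nonneg _) fun i _ => hf i

/-- The half-open form makes the slice at a fixed last variable a simplex of the same kind, which
drives the Fubini induction. -/
theorem mem_halfOpenSimplex_succ {m : ℕ} {r : ℝ} {t : Fin (m + 1) → ℝ} :
    t ∈ halfOpenSimplex (m + 1) r ↔ t (Fin.last m) ∈ Set.Ico 0 r ∧
      (fun i => t i.castSucc) ∈ halfOpenSimplex m (t (Fin.last m)) := by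
  constructor
  · rintro ⟨h1, h2⟩
    exact ⟨h1 _, fun i => ⟨(h1 _).1, h2 i.castSucc_lt_last⟩,
      fun i j hij => h2 (Fin.castSucc_lt_castSucc_iff.2 hij)⟩
  · rintro ⟨h1, h2, h3⟩
    refine ⟨fun i => ?_, fun i j hij => ?_⟩
    · induction i using Fin.lastCases with
      | last => exact h1
      | cast i => exact ⟨(h2 i).1, (h2 i).2.trans h1.2⟩
    · induction j using Fin.lastCases with
      | last =>
        induction i using Fin.lastCases with
        | last => exact absurd hij (lt_irrefl _)
        | cast i => exact (h2 i).2
      | cast j =>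
        induction i using Fin.lastCases with
        | last => exact absurd (hij.trans j.castSucc_lt_last) (lt_irrefl _)
        | cast i => exact h3 (Fin.castSucc_lt_castSucc_iff.1 hij)

theorem setIntegral_halfOpenSimplex {C : ℝ} : ∀ {m : ℕ} {k : Fin m → ℝ → ℝ},
    (∀ i, Measurable (k i)) → (∀ i t, |k i t| ≤ C) → ∀ {r : ℝ}, 0 ≤ r →
      ∫ t in halfOpenSimplex m r, ∏ i, k i (t i) = iteratedIntegral m k r := by
  intro m
  induction m with
  | zero =>
    intro k hk hC r hr
    have : halfOpenSimplex 0 r = Set.univ := by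
      ext t; simp [halfOpenSimplex, Subsingleton.strictMono]
    rw [this, iteratedIntegral, Measure.restrict_univ, volume_pi, Measure.pi_of_empty]
    simp
  | succ m ih =>
    intro k hk hC r hr
    have hint : Integrable ((halfOpenSimplex (m + 1) r).indicator fun t => ∏ i, k i (t i)) := by
      rw [integrable_indicator_iff (measurableSet_halfOpenSimplex _ _)]
      exact integrableOn_of_abs_le (volume_halfOpenSimplex_ne_top _ _)
        (Finset.measurable_prod _ fun i _ => (hk i).comp (measurable_pi_apply i))
        fun t => abs_prod_le_pow fun i => hC i _
    have he := (volume_preserving_piFinSuccAbove (fun _ : Fin (m + 1) => ℝ) (Fin.last m)).symm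
    rw [← integral_indicator (measurableSet_halfOpenSimplex _ _), ← he.integral_comp',
      Measure.volume_eq_prod, integral_prod]
    · rw [iteratedIntegral, intervalIntegral.integral_of_le hr, ← integral_Ico_eq_integral_Ioc,
        ← integral_indicator measurableSet_Ico]
      refine integral_congr_ae (Eventually.of_forall fun u => ?_)
      have hlast : ∀ s : Fin m → ℝ, (MeasurableEquiv.piFinSuccAbove (fun _ => ℝ) (Fin.last m)).symm
          (u, s) (Fin.last m) = u := fun s => by simp [MeasurableEquiv.piFinSuccAbove]
      have hcast : ∀ (s : Fin m → ℝ) (i : Fin m),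
          (MeasurableEquiv.piFinSuccAbove (fun _ => ℝ) (Fin.last m)).symm
          (u, s) i.castSucc = s i := fun s i => by simp [MeasurableEquiv.piFinSuccAbove]
      by_cases hu : u ∈ Set.Ico 0 r
      · rw [Set.indicator_of_mem hu]
        dsimp only
        rw [← ih (fun i => hk i.castSucc) (fun i => hC i.castSucc) hu.1, ← integral_mul_const,
          ← integral_indicator (measurableSet_halfOpenSimplex _ _)]
        congr 1
        funext s
        by_cases hs : s ∈ halfOpenSimplex m u
        · rw [Set.indicator_of_mem hs, Set.indicator_of_mem, Fin.prod_univ_castSucc]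
          · simp only [hlast, hcast]
          · rw [mem_halfOpenSimplex_succ]
            simp only [hlast, hcast]
            exact ⟨hu, hs⟩
        · rw [Set.indicator_of_notMem hs, Set.indicator_of_notMem]
          rw [mem_halfOpenSimplex_succ]
          simp only [hlast, hcast]
          exact fun h => hs h.2
      · rw [Set.indicator_of_notMem hu]
        refine integral_eq_zero_of_ae (Eventually.of_forall fun s => ?_)
        refine Set.indicator_of_notMem ?_ _
        rw [mem_halfOpenSimplex_succ]
        simp only [hlast]
        exact fun h => hu h.1
    · exact (he.integrable_comp_emb (MeasurableEquiv.measurableEmbedding _)).2 hint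

/-- The increment from `s` to `t` integrates the inner iterated integral, continuous and by
induction a function of `φ`, against `h'` over a loop. -/
theorem IsArcSystem.iteratedIntegral_factorsThrough {T : Type*} [MetricSpace T]
    {S : T → T → Set T} (hS : IsArcSystem S) {φ : ℝ → T} (hφ : Continuous φ) {K : NNReal} :
    ∀ {m : ℕ} {h : Fin m → ℝ → ℝ}, (∀ i, LipschitzWith K (h i)) →
      (∀ i s t, φ s = φ t → h i s = h i t) → ∀ s t, φ s = φ t →
      iteratedIntegral m (fun i => deriv (h i)) s = iteratedIntegral m (fun i => deriv (h i)) t := by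
  intro m
  induction m with
  | zero => intros; rfl
  | succ m ih =>
    intro h hh hhφ s t hst
    wlog hle : s ≤ t generalizing s t
    · exact (this t s hst.symm (le_of_not_ge hle)).symm
    have hc : Continuous (iteratedIntegral m fun i => deriv (h i.castSucc)) :=
      continuous_iteratedIntegral (fun i => measurable_deriv _) fun i t =>
        norm_deriv_le_of_lipschitz (hh _)
    have hi : ∀ a b, IntervalIntegrable (fun u => iteratedIntegral m
        (fun i => deriv (h i.castSucc)) u * deriv (h (Fin.last m)) u) volume a b := fun a b =>
      (intervalIntegrable_of_abs_le (measurable_deriv _)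
        (fun t => norm_deriv_le_of_lipschitz (hh _)) a b).continuousOn_mul hc.continuousOn
    have := hS.intervalIntegral_mul_deriv_eq_zero hφ (hh (Fin.last m)) (hhφ _) hc
      (ih (fun i => hh i.castSucc) fun i => hhφ i.castSucc) hle hst
    rw [← intervalIntegral.integral_interval_sub_left (hi 0 t) (hi 0 s), sub_eq_zero] at this
    exact this.symm

/-! ### Fubini over products of permuted simplices. -/

theorem measurePreserving_swap (m d : ℕ) :
    MeasurePreserving (Function.swap : (Fin m → Fin d → ℝ) → (Fin d → Fin m → ℝ)) := by
  have hmeas : Measurable (Function.swap : (Fin m → Fin d → ℝ) → (Fin d → Fin m → ℝ)) :=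
    measurable_pi_iff.2 fun j => measurable_pi_iff.2 fun i =>
      (measurable_pi_apply j).comp (measurable_pi_apply i)
  refine ⟨hmeas, ?_⟩
  symm
  let C : Fin d → Set (Set (Fin m → ℝ)) := fun _ =>
    Set.pi Set.univ '' Set.pi Set.univ fun _ => {s : Set ℝ | MeasurableSet s}
  refine Measure.pi_eq_generateFrom (C := C) (fun _ => generateFrom_pi) (fun _ => isPiSystem_pi)
    (fun _ => ?_) fun s hs => ?_
  · exact Measure.FiniteSpanningSetsIn.pi fun _ => (volume : Measure ℝ).toFiniteSpanningSetsIn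
  · choose u hu hus using hs
    have hum : ∀ j i, MeasurableSet (u j i) := fun j i => hu j i (Set.mem_univ i)
    have : (Function.swap : (Fin m → Fin d → ℝ) → (Fin d → Fin m → ℝ)) ⁻¹' Set.pi Set.univ s =
        Set.pi Set.univ fun i => Set.pi Set.univ fun j => u j i := by
      ext t
      simp only [← hus, Set.mem_preimage, Set.mem_pi, Set.mem_univ, true_imp_iff]
      exact forall_comm
    rw [Measure.map_apply hmeas (MeasurableSet.univ_pi fun j => ?_), this, volume_pi_pi]
    · simp_rw [← hus, volume_pi_pi]
      exact Finset.prod_comm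
    · rw [← hus]
      exact MeasurableSet.univ_pi (hum j)

theorem setIntegral_permutedSimplex {m : ℕ} (ρ : Equiv.Perm (Fin m)) (K : Fin m → ℝ → ℝ) :
    ∫ t in permutedSimplex ρ, ∏ i, K i (t i) =
      ∫ t in permutedSimplex 1, ∏ i, K (ρ i) (t i) := by
  have hp := volume_measurePreserving_piCongrLeft (fun _ : Fin m => ℝ) ρ.symm
  have happ : ∀ (t : Fin m → ℝ) (i : Fin m),
      MeasurableEquiv.piCongrLeft (fun _ : Fin m => ℝ) ρ.symm t i = t (ρ i) := fun t i => by
    conv_lhs => rw [← ρ.symm_apply_apply i]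
    exact Equiv.piCongrLeft_apply_apply (fun _ => ℝ) ρ.symm t (ρ i)
  rw [← hp.setIntegral_preimage_emb (MeasurableEquiv.measurableEmbedding _) _ (permutedSimplex 1)]
  have hset : MeasurableEquiv.piCongrLeft (fun _ : Fin m => ℝ) ρ.symm ⁻¹' permutedSimplex 1 =
      permutedSimplex ρ := by
    ext t
    simp only [permutedSimplex, Set.mem_preimage, Set.mem_ofPred_eq, happ, Equiv.Perm.one_apply]
    refine and_congr_left fun _ => ⟨fun h i => ?_, fun h i => h _⟩
    simpa using h (ρ.symm i)
  rw [hset]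
  simp only [happ]
  congr 1
  funext t
  exact (Equiv.prod_comp ρ fun i => K i (t i)).symm

theorem measurableSet_permutedSimplex {m : ℕ} (ρ : Equiv.Perm (Fin m)) :
    MeasurableSet (permutedSimplex ρ) := by
  have : permutedSimplex ρ = (Set.univ.pi fun _ => Set.Icc (0 : ℝ) 1) ∩
      {t | StrictMono fun i => t (ρ i)} := by
    ext t; simp only [permutedSimplex, Set.mem_ofPred_eq, Set.mem_inter_iff, Set.mem_univ_pi]
  rw [this]
  exact (MeasurableSet.univ_pi fun _ => measurableSet_Icc).inter (measurableSet_strictMono_comp ρ)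

theorem volume_permutedSimplex_ne_top {m : ℕ} (ρ : Equiv.Perm (Fin m)) :
    volume (permutedSimplex ρ) ≠ ⊤ := by
  refine ((measure_mono (t := Set.univ.pi fun _ => Set.Icc 0 1) fun t ht i _ => ht.1 i).trans_lt
    ?_).ne
  rw [volume_pi_pi]
  exact ENNReal.prod_lt_top fun i _ => measure_Icc_lt_top

theorem integrationDomain_eq_preimage {m d : ℕ} (π : Fin d → Equiv.Perm (Fin m)) :
    integrationDomain π = Function.swap ⁻¹' Set.univ.pi fun j => permutedSimplex (π j) := by
  ext t; simp [integrationDomain]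

theorem measurableSet_integrationDomain {m d : ℕ} (π : Fin d → Equiv.Perm (Fin m)) :
    MeasurableSet (integrationDomain π) := by
  rw [integrationDomain_eq_preimage]
  exact (measurePreserving_swap m d).measurable
    (MeasurableSet.univ_pi fun j => measurableSet_permutedSimplex _)

theorem volume_integrationDomain_ne_top {m d : ℕ} (π : Fin d → Equiv.Perm (Fin m)) :
    volume (integrationDomain π) ≠ ⊤ := by
  rw [integrationDomain_eq_preimage, (measurePreserving_swap m d).measure_preimage
    (MeasurableSet.univ_pi fun j => measurableSet_permutedSimplex _).nullMeasurableSet,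
    volume_pi_pi]
  exact (ENNReal.prod_lt_top fun j _ => (volume_permutedSimplex_ne_top _).lt_top).ne

/-- After exchanging rows and columns, both domain and integrand are products over `j`; relabelling
the variables of column `j` by `π j` moves the permutation into the index of `K`. -/
theorem setIntegral_integrationDomain {m d : ℕ} (π : Fin d → Equiv.Perm (Fin m))
    (K : Fin m → Fin d → ℝ → ℝ) :
    ∫ t in integrationDomain π, ∏ i, ∏ j, K i j (t i j) =
      ∏ j, ∫ t in permutedSimplex 1, ∏ i, K (π j i) j (t i) := by
  have hswap := measurePreserving_swap m d
  let e : (Fin m → Fin d → ℝ) ≃ᵐ (Fin d → Fin m → ℝ) :=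
    ⟨Equiv.piComm _, hswap.measurable, (measurePreserving_swap d m).measurable⟩
  have he : MeasurePreserving e := hswap
  have h1 : ∀ t : Fin m → Fin d → ℝ, ∏ i, ∏ j, K i j (t i j) =
      (fun τ : Fin d → Fin m → ℝ => ∏ j, ∏ i, K i j (τ j i)) (e t) := fun t => Finset.prod_comm
  rw [integral_congr_ae (Eventually.of_forall h1)]
  rw [Finset.prod_congr rfl fun j _ => (setIntegral_permutedSimplex (π j) fun i => K i j).symm]
  have h2 : integrationDomain π = e ⁻¹' Set.univ.pi fun j => permutedSimplex (π j) :=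
    integrationDomain_eq_preimage π
  rw [h2]
  refine (he.setIntegral_preimage_emb e.measurableEmbedding
    (fun τ : Fin d → Fin m → ℝ => ∏ j, ∏ i, K i j (τ j i)) _).trans ?_
  rw [volume_pi, Measure.restrict_pi_pi]
  exact integral_fintype_prod_eq_prod (fun j (τ : Fin m → ℝ) => ∏ i, K i j (τ i))

theorem ae_forall_mem_Ioo (m : ℕ) :
    ∀ᵐ t : Fin m → ℝ, ∀ i, t i ∈ Set.Icc (0 : ℝ) 1 → t i ∈ Set.Ioo (0 : ℝ) 1 := by
  have h : ∀ᵐ t : ℝ, t ∈ Set.Icc (0 : ℝ) 1 → t ∈ Set.Ioo (0 : ℝ) 1 := by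
    filter_upwards [Measure.ae_ne volume (0 : ℝ), Measure.ae_ne volume (1 : ℝ)] with t h0 h1 ht
    exact ⟨lt_of_le_of_ne ht.1 h0.symm, lt_of_le_of_ne ht.2 h1⟩
  exact eventually_all.2 fun i => (Measure.tendsto_eval_ae_ae (μ := fun _ : Fin m =>
    (volume : Measure ℝ)) (i := i)).eventually h

theorem ae_forall_forall_mem_Ioo (m d : ℕ) : ∀ᵐ t : Fin m → Fin d → ℝ,
    ∀ i j, t i j ∈ Set.Icc (0 : ℝ) 1 → t i j ∈ Set.Ioo (0 : ℝ) 1 :=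
  eventually_all.2 fun i => (Measure.tendsto_eval_ae_ae (μ := fun _ : Fin m =>
    (volume : Measure (Fin d → ℝ))) (i := i)).eventually (ae_forall_mem_Ioo d)

theorem setIntegral_permutedSimplex_one {m : ℕ} {C : ℝ} {k : Fin m → ℝ → ℝ}
    (hk : ∀ i, Measurable (k i)) (hC : ∀ i t, |k i t| ≤ C) :
    ∫ t in permutedSimplex 1, ∏ i, k i (t i) = iteratedIntegral m k 1 := by
  rw [← setIntegral_halfOpenSimplex hk hC zero_le_one]
  refine setIntegral_congr_set ?_
  filter_upwards [ae_forall_mem_Ioo m] with t ht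
  refine propext (and_congr_left fun _ => forall_congr' fun i => ?_)
  exact ⟨fun h => Set.Ioo_subset_Ico_self (ht i h), fun h => Set.Ico_subset_Icc_self h⟩

/-! ### Coordinates of paths and the expansion of Jacobian minors. -/

variable {V : Type*} [NormedAddCommGroup V] [InnerProductSpace ℝ V] {n d m : ℕ}
  (b : Module.Basis (Fin n) ℝ V)

/-- The `k`-th coordinate of a path on `[0,1]`, extended to the line by constants. -/
noncomputable def coordPath (g : ℝ → V) (k : Fin n) (r : ℝ) : ℝ :=
  b.repr (g (Set.projIcc (0 : ℝ) 1 zero_le_one r)) k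

theorem exists_lipschitzWith_coordPath {g : ℝ → V} {K : NNReal}
    (hg : LipschitzOnWith K g (Set.Icc 0 1)) : ∃ K', ∀ k, LipschitzWith K' (coordPath b g k) := by
  have := b.finiteDimensional_of_finite
  let L : Fin n → V →L[ℝ] ℝ := fun k => (b.coord k).toContinuousLinearMap
  refine ⟨(∑ k, ‖L k‖₊) * K, fun k => ?_⟩
  have h1 : LipschitzWith (‖L k‖₊ * (K * 1)) (coordPath b g k) :=
    (L k).lipschitz.comp ((hg.to_restrict).comp (LipschitzWith.projIcc zero_le_one))
  refine h1.weaken ?_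
  rw [mul_one]
  gcongr
  exact Finset.single_le_sum (f := fun k => ‖L k‖₊) (fun _ _ => zero_le) (Finset.mem_univ k)

/-- The endpoints are excluded since the constant extension can alter the derivative there; they
form a null set in all integrals. -/
theorem derivWithin_eq_deriv_coordPath (g : ℝ → V) (k : Fin n) {t : ℝ}
    (ht : t ∈ Set.Ioo (0 : ℝ) 1) :
    derivWithin (fun r => b.repr (g r) k) (Set.Icc 0 1) t = deriv (coordPath b g k) t := by
  have hn : Set.Icc (0 : ℝ) 1 ∈ 𝓝 t := Icc_mem_nhds ht.1 ht.2
  rw [derivWithin_of_mem_nhds hn]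
  refine EventuallyEq.deriv_eq ?_
  filter_upwards [hn] with r hr
  rw [coordPath, Set.projIcc_of_mem _ hr]

theorem pathIntegrand_ae_eq (g : ℝ → V) (I : Fin m → Fin n) :
    pathIntegrand b g I =ᵐ[volume.restrict (permutedSimplex 1)]
      fun t => ∏ i, deriv (coordPath b g (I i)) (t i) := by
  refine (ae_restrict_iff' (measurableSet_permutedSimplex 1)).2 ?_
  filter_upwards [ae_forall_mem_Ioo m] with t ht htm
  exact Finset.prod_congr rfl fun i _ =>
    derivWithin_eq_deriv_coordPath b g (I i) (ht i (htm.1 i))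

theorem partialDeriv_eq_derivWithin {g : Fin d → ℝ → V} {x : (Fin d → ℝ) → V}
    (hx : ∀ s ∈ cube d, x s = ∑ j, g j (s j)) {s : Fin d → ℝ} (hs : s ∈ cube d) (k : Fin n)
    (j : Fin d) :
    partialDeriv b x k j s = derivWithin (fun r => b.repr (g j r) k) (Set.Icc 0 1) (s j) := by
  have h : ∀ r ∈ Set.Icc (0 : ℝ) 1, b.repr (x (Function.update s j r)) k =
      (∑ l ∈ Finset.univ.erase j, b.repr (g l (s l)) k) + b.repr (g j r) k := by
    intro r hr
    rw [hx, ← Finset.sum_erase_add _ _ (Finset.mem_univ j), map_add, map_sum,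
      Finsupp.add_apply, Finsupp.finsetSum_apply, Function.update_self]
    · congr 1
      refine Finset.sum_congr rfl fun l hl => ?_
      rw [Function.update_of_ne (Finset.ne_of_mem_erase hl)]
    · intro l
      rcases eq_or_ne l j with rfl | hl
      · rwa [Function.update_self]
      · rw [Function.update_of_ne hl]; exact hs l
  rw [partialDeriv, derivWithin_congr h (h _ (hs j)), derivWithin_const_add]

theorem jacobianMinor_eq_sum {g : Fin d → ℝ → V} {x : (Fin d → ℝ) → V}
    (hx : ∀ s ∈ cube d, x s = ∑ j, g j (s j)) {s : Fin d → ℝ}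
    (hs : ∀ j, s j ∈ Set.Ioo (0 : ℝ) 1) (P : Fin d ↪o Fin n) :
    jacobianMinor b x P s = ∑ σ : Equiv.Perm (Fin d), ((Equiv.Perm.sign σ : ℤ) : ℝ) *
      ∏ j, deriv (coordPath b (g j) (P (σ⁻¹ j))) (s j) := by
  -- The Leibniz formula has `P (σ j)` in column `j`; the sum is reindexed by inversion, which
  -- preserves signs.
  rw [jacobianMinor, Matrix.det_apply', ← Equiv.sum_comp (Equiv.inv _)]
  refine Finset.sum_congr rfl fun σ _ => ?_
  rw [Equiv.inv_apply, Equiv.Perm.sign_inv]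
  congr 1
  refine Finset.prod_congr rfl fun j _ => ?_
  rw [Matrix.of_apply, partialDeriv_eq_derivWithin b hx fun j => Set.Ioo_subset_Icc_self (hs j),
    derivWithin_eq_deriv_coordPath b _ _ (hs j)]

theorem monomialIntegrand_ae_eq {g : Fin d → ℝ → V} {x : (Fin d → ℝ) → V}
    (hx : ∀ s ∈ cube d, x s = ∑ j, g j (s j)) (P : Fin m → (Fin d ↪o Fin n))
    (π : Fin d → Equiv.Perm (Fin m)) :
    monomialIntegrand b x P =ᵐ[volume.restrict (integrationDomain π)] fun t =>
      ∑ σ : Fin m → Equiv.Perm (Fin d), (∏ i, ((Equiv.Perm.sign (σ i) : ℤ) : ℝ)) *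
        ∏ i, ∏ j, deriv (coordPath b (g j) (P i ((σ i)⁻¹ j))) (t i j) := by
  refine (ae_restrict_iff' (measurableSet_integrationDomain π)).2 ?_
  filter_upwards [ae_forall_forall_mem_Ioo m d] with t ht htm
  rw [monomialIntegrand, Finset.prod_congr rfl fun i _ =>
    jacobianMinor_eq_sum b hx (fun j => ht i j ((htm j).1 i)) (P i), Finset.prod_univ_sum,
    Fintype.piFinset_univ]
  exact Finset.sum_congr rfl fun σ _ => Finset.prod_mul_distrib

theorem pathSignature_eq_iteratedIntegral {g : ℝ → V} {K : NNReal}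
    (hg : ∀ k, LipschitzWith K (coordPath b g k)) (I : Fin m → Fin n) :
    pathSignature b g I = iteratedIntegral m (fun i => deriv (coordPath b g (I i))) 1 := by
  rw [pathSignature, integral_congr_ae (pathIntegrand_ae_eq b g I)]
  exact setIntegral_permutedSimplex_one (fun i => measurable_deriv _) fun i t =>
    norm_deriv_le_of_lipschitz (hg _)

theorem IsTreeLike.pathSignature_eq_zero {g : ℝ → V} (hT : IsTreeLike.{u} g) {K : NNReal}
    (hg : ∀ k, LipschitzWith K (coordPath b g k)) (hm : 1 ≤ m) (I : Fin m → Fin n) :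
    pathSignature b g I = 0 := by
  obtain ⟨T, _, φ, ψ, hRT, hφ, hgφ⟩ := hT
  obtain ⟨S, hS⟩ := hRT.exists_isArcSystem
  obtain ⟨m, rfl⟩ := Nat.exists_eq_succ_of_ne_zero (Nat.one_le_iff_ne_zero.1 hm)
  -- The loop closes up, so the endpoint `1` may be replaced by `0`, where the outermost integral is
  -- over an empty range.
  rw [pathSignature_eq_iteratedIntegral b hg, hS.iteratedIntegral_factorsThrough
    (φ := fun t => φ (Set.projIcc 0 1 zero_le_one t)) (t := 0)
    (φ.continuous.comp continuous_projIcc) (fun i => hg (I i))]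
  · rw [iteratedIntegral, intervalIntegral.integral_same]
  · intro i s t hst
    rw [coordPath, coordPath, hgφ, hgφ, hst]
  · simp only [Set.projIcc_left, Set.projIcc_right]
    exact hφ.symm

end MappingSpaceSignature

/-! ### The signature formula and the vanishing for tree-like paths. -/

open MappingSpaceSignature in
theorem mainTheorem9 {V : Type*} [NormedAddCommGroup V] [InnerProductSpace ℝ V] {n d m : ℕ}
    (b : Module.Basis (Fin n) ℝ V)
    (g : Fin d → ℝ → V) (hg : ∀ j, ∃ K, LipschitzOnWith K (g j) (Set.Icc 0 1))
    (x : (Fin d → ℝ) → V) (hx : ∀ s ∈ MappingSpaceSignature.cube d, x s = ∑ j, g j (s j))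
    (P : Fin m → (Fin d ↪o Fin n)) (π : Fin d → Equiv.Perm (Fin m)) :
    IntegrableOn (MappingSpaceSignature.monomialIntegrand b x P)
        (MappingSpaceSignature.integrationDomain π) ∧
      (∀ (j : Fin d) (I : Fin m → Fin n),
        IntegrableOn (MappingSpaceSignature.pathIntegrand b (g j) I)
          (MappingSpaceSignature.permutedSimplex 1)) ∧
      MappingSpaceSignature.mappingSpaceMonomial b x P π =
        ∑ σ : Fin m → Equiv.Perm (Fin d),
          (∏ i, ((Equiv.Perm.sign (σ i) : ℤ) : ℝ)) *
            ∏ j, MappingSpaceSignature.pathSignature b (g j)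
              (MappingSpaceSignature.multiIndex P π σ j) ∧
      (1 ≤ m → (∃ j, MappingSpaceSignature.IsTreeLike.{u} (g j)) →
        MappingSpaceSignature.mappingSpaceMonomial b x P π = 0) := by
  have hlip : ∃ K, ∀ j k, LipschitzWith K (coordPath b (g j) k) := by
    choose K hK using hg
    choose K' hK' using fun j => exists_lipschitzWith_coordPath b (hK j)
    exact ⟨∑ j, K' j, fun j k => (hK' j k).weaken
      (Finset.single_le_sum (f := K') (fun _ _ => zero_le) (Finset.mem_univ j))⟩
  obtain ⟨K, hK⟩ := hlip
  have hterm : ∀ σ : Fin m → Equiv.Perm (Fin d), IntegrableOn (fun t : Fin m → Fin d → ℝ =>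
      (∏ i, ((Equiv.Perm.sign (σ i) : ℤ) : ℝ)) *
        ∏ i, ∏ j, deriv (coordPath b (g j) (P i ((σ i)⁻¹ j))) (t i j)) (integrationDomain π) := by
    intro σ
    refine Integrable.const_mul (integrableOn_of_abs_le (volume_integrationDomain_ne_top π) ?_
      fun t => abs_prod_le_pow fun i => abs_prod_le_pow fun j =>
        norm_deriv_le_of_lipschitz (hK _ _)) _
    exact Finset.measurable_prod _ fun i _ => Finset.measurable_prod _ fun j _ =>
      (measurable_deriv _).comp ((measurable_pi_apply j).comp (measurable_pi_apply i))
  have hformula : mappingSpaceMonomial b x P π = ∑ σ : Fin m → Equiv.Perm (Fin d),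
      (∏ i, ((Equiv.Perm.sign (σ i) : ℤ) : ℝ)) *
        ∏ j, pathSignature b (g j) (multiIndex P π σ j) := by
    rw [mappingSpaceMonomial, integral_congr_ae (monomialIntegrand_ae_eq b hx P π),
      integral_finsetSum _ fun σ _ => hterm σ]
    refine Finset.sum_congr rfl fun σ _ => ?_
    rw [integral_const_mul, setIntegral_integrationDomain π
      fun i j => deriv (coordPath b (g j) (P i ((σ i)⁻¹ j)))]
    congr 1
    refine Finset.prod_congr rfl fun j _ => ?_
    rw [pathSignature, integral_congr_ae (pathIntegrand_ae_eq b (g j) _)]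
    rfl
  refine ⟨(integrable_finsetSum _ fun σ _ => hterm σ).congr
    (monomialIntegrand_ae_eq b hx P π).symm, fun j I => ?_, hformula, fun hm hT => ?_⟩
  · refine Integrable.congr ?_ (pathIntegrand_ae_eq b (g j) I).symm
    exact integrableOn_of_abs_le (volume_permutedSimplex_ne_top 1)
      (Finset.measurable_prod _ fun i _ => (measurable_deriv _).comp (measurable_pi_apply i))
      fun t => abs_prod_le_pow fun i => norm_deriv_le_of_lipschitz (hK _ _)
  · obtain ⟨j, hj⟩ := hT
    rw [hformula]
    refine Finset.sum_eq_zero fun σ _ => ?_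
    rw [Finset.prod_eq_zero (Finset.mem_univ j)
      (hj.pathSignature_eq_zero b (hK j) hm _), mul_zero]
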